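/- Conventions. A $C^0$-manifold with boundary of dimension $n\ge 0$ is a second-countable Hausdorff space with an atlas of local homeomorphisms to open subsets of $[0,\infty)\times\mathbb{R}^{n-1}$ (a single point with empty boundary if $n=0$); its boundary is the union of the preimages of $\{0\}\times\mathbb{R}^{n-1}$ under the charts. A $C^0$-manifold with boundary is a finite disjoint union $X=\bigsqcup_{n=0}^N X_n$ of such manifolds $X_n$ of dimension $n$; its boundary is $\partial X=\bigsqcup_n\partial X_n$ and its interior is $X^\circ=X\setminus\partial X$. A system of boundary faces for $X$ is a finite collection of topological embeddings $\phi_i\colon F_i\to X$, $i\in I$, of $C^0$-manifolds with boundary $F_i$ such that (i) $\phi_i(F_i)\subset\partial X$, and $\phi_i(F_i^\circ)$ is open in $\partial X$; (ii) $\phi_i(F_i^\circ)\cap\phi_j(F_j^\circ)=\emptyset$ for $i\neq j$; (iii) $\overline{\bigcup_i\phi_i(F_i^\circ)}=\partial X$. Let $\Lambda=\bigl\{\sum_{l=0}^\infty a_lT^{\lambda_l}\,\big|\,a_l\in\mathbb{Z}_2,\ \lambda_l\in\mathbb{R},\ \lim_{l\to\infty}\lambda_l=+\infty\bigr\}$ be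 the universal Novikov field (finite sums included). Let $Y$ be a $0$-dimensional $C^0$-manifold with an energy function $\mathcal{E}\colon Y\to\mathbb{R}$ whose set of values is $\{E_0<E_1<\dots\}$, either finite or with $E_l\to\infty$, and whose level sets $\mathcal{E}^{-1}(E_l)$ are all finite. The Novikov count of $Y$ is $\#_\Lambda Y=\sum_l \bigl(\#\mathcal{E}^{-1}(E_l)\bmod 2\bigr)\,T^{E_l}\in\Lambda$. Lemma. Let $X$ be a $1$-dimensional $C^0$-manifold with boundary, let $(\phi_i\colon F_i\to X)_{i\in I}$ be a system of boundary faces for $X$, and let $\mathcal{E}\colon X\to\mathbb{R}$ be a locally constant function such that $\mathcal{E}^{-1}((-\infty,E])$ is compact for all $E\in\mathbb{R}$. Then every $F_i$ is a $0$-dimensional $C^0$-manifold whose Novikov count with respect to the induced energy function $\mathcal{E}\circ\phi_i\colon F_i\to\mathbb{R}$ is defined, and $$\sum_{i\in I}\#_\Lambda F_i=0\quad\in\Lambda .$$ -/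

import Mathlib

open Set

/-- The half-space `[0, ∞) × ℝ^(n-1)`: points of `ℝ^n` whose coordinate of index `0` is
nonnegative. For `n = 0` it is a single point. -/
abbrev HalfSpace (n : ℕ) : Type :=
  {v : Fin n → ℝ // ∀ j : Fin n, (j : ℕ) = 0 → 0 ≤ v j}

/-- The boundary `{0} × ℝ^(n-1)` of the half-space. It is empty for `n = 0`. -/
def HalfSpace.boundary (n : ℕ) : Set (HalfSpace n) :=
  {v | ∃ j : Fin n, (j : ℕ) = 0 ∧ v.1 j = 0}

/-- A topological manifold with boundary which is a finite disjoint union of parts `X_n` of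
dimension `n`, for `0 ≤ n ≤ N`: a second-countable Hausdorff space, with the function `dim` whose
fibres are the parts `X_n`, and for each `n` an atlas of `X_n` of local homeomorphisms onto open
subsets of the `n`-dimensional half-space. Transition maps are automatically continuous. The parts
are open in `X`, because each of them is the union of the (open) sources of its charts. -/
class C0Manifold (X : Type*) [TopologicalSpace X] extends
    T2Space X, SecondCountableTopology X where
  dim : X → ℕ
  bddAbove_dim : BddAbove (range dim)
  charts : (n : ℕ) → Set (OpenPartialHomeomorph X (HalfSpace n))
  dim_eq_of_mem_source : ∀ n, ∀ e ∈ charts n, ∀ x ∈ e.source, dim x = n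
  exists_chart : ∀ x, ∃ e ∈ charts (dim x), x ∈ e.source

namespace C0Manifold

/-- The manifold has dimension `n`, i.e. it equals its `n`-dimensional part. -/
def HasDimension (X : Type*) [TopologicalSpace X] [C0Manifold X] (n : ℕ) : Prop :=
  ∀ x : X, dim x = n

/-- The boundary: the union of the preimages of the boundary of the half-space under all charts. -/
def boundary (X : Type*) [TopologicalSpace X] [C0Manifold X] : Set X :=
  {x | ∃ n, ∃ e ∈ charts (X := X) n, x ∈ e.source ∧ e x ∈ HalfSpace.boundary n}

/-- The interior: the complement of the boundary. -/
def interior (X : Type*) [TopologicalSpace X] [C0Manifold X] : Set X :=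
  (boundary X)ᶜ

end C0Manifold

/-- The maps `φ i : F i → X` form a system of (codimension 1) boundary faces for `X`. -/
structure IsSystemOfBoundaryFaces {X : Type*} [TopologicalSpace X] [C0Manifold X]
    {I : Type*} [Finite I] {F : I → Type*} [∀ i, TopologicalSpace (F i)] [∀ i, C0Manifold (F i)]
    (φ : ∀ i, F i → X) : Prop where
  isEmbedding : ∀ i, Topology.IsEmbedding (φ i)
  range_subset : ∀ i, range (φ i) ⊆ C0Manifold.boundary X
  /-- The image of the interior of each face is open in the subspace `∂X`. -/
  isOpen_image_interior : ∀ i, ∃ U : Set X, IsOpen U ∧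
    φ i '' C0Manifold.interior (F i) = U ∩ C0Manifold.boundary X
  disjoint_interiors : ∀ i j, i ≠ j →
    Disjoint (φ i '' C0Manifold.interior (F i)) (φ j '' C0Manifold.interior (F j))
  closure_eq : closure (⋃ i, φ i '' C0Manifold.interior (F i)) = C0Manifold.boundary X

/-- Series with finitely many terms of exponent at most `c`, for each `c`, are closed under products. -/
theorem novikov_mul_mem {x y : HahnSeries ℝ (ZMod 2)}
    (hx : ∀ c : ℝ, (x.support ∩ Iic c).Finite) (hy : ∀ c : ℝ, (y.support ∩ Iic c).Finite)
    (c : ℝ) : ((x * y).support ∩ Iic c).Finite := by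
  by_cases hx0 : x = 0
  · simp [hx0]
  by_cases hy0 : y = 0
  · simp [hy0]
  refine ((hx (c - y.order)).image2 (fun a b => a + b) (hy (c - x.order))).subset ?_
  rintro z ⟨hz, hzc⟩
  obtain ⟨a, ha, b, hb, rfl⟩ := HahnSeries.support_mul_subset hz
  have h1 := HahnSeries.order_le_of_coeff_ne_zero ha
  have h2 := HahnSeries.order_le_of_coeff_ne_zero hb
  have h3 : a + b ≤ c := hzc
  exact ⟨a, ⟨ha, by simp only [mem_Iic]; linarith⟩, b, ⟨hb, by simp only [mem_Iic]; linarith⟩, rfl⟩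

/-- The universal Novikov field `Λ` over `ℤ/2`, as a subring of the ring of Hahn series with real
exponents: the series `∑ a_l T^(λ_l)` that are finite sums or have `λ_l → ∞`, i.e. those with only
finitely many nonzero terms of exponent at most `c`, for each real `c`. -/
def Novikov : Subring (HahnSeries ℝ (ZMod 2)) where
  carrier := {x | ∀ c : ℝ, (x.support ∩ Iic c).Finite}
  mul_mem' hx hy := novikov_mul_mem hx hy
  one_mem' c := (finite_singleton (0 : ℝ)).subset
    (inter_subset_left.trans HahnSeries.support_single_subset)
  add_mem' {x y} hx hy c := ((hx c).union (hy c)).subset (by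
    rintro z ⟨hz, hzc⟩
    rcases HahnSeries.support_add_subset _ _ hz with h | h
    exacts [Or.inl ⟨h, hzc⟩, Or.inr ⟨h, hzc⟩])
  zero_mem' c := by simp
  neg_mem' {x} hx c := by simpa using hx c

/-- The conditions under which a Novikov count is defined: `Y` is a `0`-dimensional manifold with
an energy function whose set of values is discrete and either finite or a sequence increasing to
`∞` (i.e. only finitely many values are at most `c`, for each real `c`), and whose level sets are
finite. -/
structure HasNovikovCount {Y : Type*} [TopologicalSpace Y] [C0Manifold Y] (E : Y → ℝ) :
    Prop where
  zero_dim : C0Manifold.HasDimension Y 0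
  finite_values : ∀ c : ℝ, (range E ∩ Iic c).Finite
  finite_level : ∀ c : ℝ, (E ⁻¹' {c}).Finite

theorem HasNovikovCount.support_subset {Y : Type*} [TopologicalSpace Y] [C0Manifold Y]
    {E : Y → ℝ} :
    Function.support (fun c : ℝ => ((E ⁻¹' {c}).ncard : ZMod 2)) ⊆ range E := by
  intro c hc
  by_contra h
  refine hc ?_
  have : E ⁻¹' {c} = ∅ := preimage_singleton_eq_empty.2 h
  simp [this]

theorem HasNovikovCount.isPWO {Y : Type*} [TopologicalSpace Y] [C0Manifold Y]
    {E : Y → ℝ} (h : HasNovikovCount E) : (range E).IsPWO := by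
  refine Set.isPWO_iff_isWF.2 (isWF_iff_no_descending_seq.2 fun f hf hmem => ?_)
  refine infinite_range_of_injective hf.injective ((h.finite_values (f 0)).subset ?_)
  rintro _ ⟨n, rfl⟩
  exact ⟨hmem n, hf.antitone (Nat.zero_le n)⟩

/-- The Novikov count `#_Λ Y`: the series in which the coefficient of `T^c` is the number of points
of energy `c`, modulo 2. -/
noncomputable def novikovCount {Y : Type*} [TopologicalSpace Y] [C0Manifold Y] (E : Y → ℝ)
    (h : HasNovikovCount E) : Novikov :=
  ⟨⟨fun c => ((E ⁻¹' {c}).ncard : ZMod 2), h.isPWO.mono HasNovikovCount.support_subset⟩,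
    fun c => (h.finite_values c).subset
      (inter_subset_inter_left _ HasNovikovCount.support_subset)⟩

/-! Each level set of the energy is compact and open, so the coefficient of `T^c` vanishes once a
compact open subset of a 1-manifold is known to have an even number of boundary points. Since the
boundary accumulates nowhere, the faces are discrete and of dimension 0, and their disjoint images
are all of the boundary.

The parity is proved without classifying 1-manifolds. To a tame function `f` with values in `ℤ/2`
one assigns at each point the sum of its limits from all sides: two sides in the interior, one on
the boundary. This `sideSum` is additive in `f` (`sideSum_add`). On the half-line the side sums of a
compactly supported function total zero (`finsum_sideLimits_eq_zero`). Cutting `f` along finitely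
many chart arcs gives the same on `X` (`finsum_sideSum_eq_zero`). For the indicator of a compact
open set, the total counts boundary points mod 2. -/

open Filter Topology
open scoped NNReal

/-! ### One-sided neighbourhoods and limits in half-line charts -/

/-- An open partial homeomorphism preserves punctured neighbourhoods. -/
theorem OpenPartialHomeomorph.symm_map_nhdsNE {X Y : Type*} [TopologicalSpace X]
    [TopologicalSpace Y] (e : OpenPartialHomeomorph X Y) {x : X} (hx : x ∈ e.source) :
    map e.symm (𝓝[≠] (e x)) = 𝓝[≠] x := by
  have h : e.symm.IsImage {e x}ᶜ {x}ᶜ := by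
    intro s hs
    have hs' : s ∈ e.target := hs
    simp only [mem_compl_iff, mem_singleton_iff, not_iff_not]
    exact ⟨fun h => by rw [← h, e.right_inv hs'], fun h => by rw [h, e.left_inv hx]⟩
  simpa [e.left_inv hx] using h.map_nhdsWithin_eq (e.map_source hx)

/-- A property holds near `x`, away from `x`, iff it holds on both sides of `x` in a chart. -/
theorem eventually_nhdsNE_iff_sides {X : Type*} [TopologicalSpace X]
    (e : OpenPartialHomeomorph X ℝ≥0) {x : X} (hx : x ∈ e.source) {p : X → Prop} :
    (∀ᶠ y in 𝓝[≠] x, p y) ↔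
      (∀ᶠ s in 𝓝[<] (e x), p (e.symm s)) ∧ ∀ᶠ s in 𝓝[>] (e x), p (e.symm s) := by
  rw [← e.symm_map_nhdsNE hx, eventually_map, ← nhdsLT_sup_nhdsGT, eventually_sup]

theorem tendsto_nhdsNE_iff_sides {X Y : Type*} [TopologicalSpace X]
    (e : OpenPartialHomeomorph X ℝ≥0) {x : X} (hx : x ∈ e.source) {f : X → Y} {l : Filter Y} :
    Tendsto f (𝓝[≠] x) l ↔
      Tendsto (f ∘ e.symm) (𝓝[<] (e x)) l ∧ Tendsto (f ∘ e.symm) (𝓝[>] (e x)) l := by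
  rw [← e.symm_map_nhdsNE hx, tendsto_map'_iff, ← nhdsLT_sup_nhdsGT, tendsto_sup]

theorem NNReal.nhdsLT_zero : 𝓝[<] (0 : ℝ≥0) = ⊥ := by
  have : Iio (0 : ℝ≥0) = ∅ := by ext; simp
  rw [this, nhdsWithin_empty]

theorem NNReal.nhdsLT_neBot {t : ℝ≥0} (ht : t ≠ 0) : (𝓝[<] t).NeBot :=
  nhdsLT_neBot_of_exists_lt ⟨0, pos_iff_ne_zero.2 ht⟩

/-- A continuous map from an interval to a discrete space is constant. -/
theorem exists_tendsto_nhdsGT {Y : Type*} [TopologicalSpace Y] [DiscreteTopology Y]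
    {h : ℝ≥0 → Y} {t : ℝ≥0} (hh : ∀ᶠ s in 𝓝[>] t, ContinuousAt h s) :
    ∃ r, Tendsto h (𝓝[>] t) (𝓝 r) := by
  obtain ⟨u, hu, hsub⟩ := mem_nhdsGT_iff_exists_Ioo_subset.1 hh
  obtain ⟨v, hv⟩ := exists_between (show t < u from hu)
  refine ⟨h v, tendsto_nhds_of_eventually_eq ?_⟩
  filter_upwards [Ioo_mem_nhdsGT (show t < u from hu)] with s hs
  exact isPreconnected_Ioo.constant
    (fun z hz => (show ContinuousAt h z from hsub hz).continuousWithinAt) hs hv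

theorem exists_tendsto_nhdsLT {Y : Type*} [TopologicalSpace Y] [DiscreteTopology Y]
    {h : ℝ≥0 → Y} {t : ℝ≥0} (ht : t ≠ 0) (hh : ∀ᶠ s in 𝓝[<] t, ContinuousAt h s) :
    ∃ r, Tendsto h (𝓝[<] t) (𝓝 r) := by
  have ht' : 0 < t := pos_iff_ne_zero.2 ht
  obtain ⟨u, hu, hsub⟩ := (mem_nhdsLT_iff_exists_Ioo_subset' ht').1 hh
  obtain ⟨v, hv⟩ := exists_between (show u < t from hu)
  refine ⟨h v, tendsto_nhds_of_eventually_eq ?_⟩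
  filter_upwards [Ioo_mem_nhdsLT (show u < t from hu)] with s hs
  exact isPreconnected_Ioo.constant
    (fun z hz => (show ContinuousAt h z from hsub hz).continuousWithinAt) hs hv

/-- A function to `ℤ/2` is tame if its discontinuities form a closed discrete set. -/
def IsTame {X : Type*} [TopologicalSpace X] (f : X → ZMod 2) : Prop :=
  ∀ x, ∀ᶠ y in 𝓝[≠] x, ContinuousAt f y

/-- The function `f` has one-sided limits `l` and `r` at `t`, and `l = 0` if there is no left
side. -/
structure HasSideLimits (h : ℝ≥0 → ZMod 2) (t : ℝ≥0) (l r : ZMod 2) : Prop where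
  left : Tendsto h (𝓝[<] t) (𝓝 l)
  right : Tendsto h (𝓝[>] t) (𝓝 r)
  left_zero : t = 0 → l = 0

theorem HasSideLimits.add {h k : ℝ≥0 → ZMod 2} {t : ℝ≥0} {l r l' r' : ZMod 2}
    (H : HasSideLimits h t l r) (K : HasSideLimits k t l' r') :
    HasSideLimits (h + k) t (l + l') (r + r') :=
  ⟨H.left.add K.left, H.right.add K.right, fun ht => by
    rw [H.left_zero ht, K.left_zero ht, add_zero]⟩

theorem HasSideLimits.congr {h k : ℝ≥0 → ZMod 2} {t : ℝ≥0} {l r : ZMod 2}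
    (H : HasSideLimits h t l r) (hk : h =ᶠ[𝓝 t] k) : HasSideLimits k t l r :=
  ⟨H.left.congr' (hk.filter_mono nhdsWithin_le_nhds),
    H.right.congr' (hk.filter_mono nhdsWithin_le_nhds), H.left_zero⟩

theorem hasSideLimits_zero (t : ℝ≥0) : HasSideLimits (fun _ => 0) t 0 0 :=
  ⟨tendsto_const_nhds, tendsto_const_nhds, fun _ => rfl⟩

/-! ### Side sums at a point -/

section Sides

variable {X : Type*} [TopologicalSpace X]

theorem exists_hasSideLimits {f : X → ZMod 2} (e : OpenPartialHomeomorph X ℝ≥0) {x : X}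
    (hx : x ∈ e.source) (hf : ∀ᶠ y in 𝓝[≠] x, ContinuousAt f y) :
    ∃ l r, HasSideLimits (f ∘ e.symm) (e x) l r := by
  have htarget : ∀ᶠ s in 𝓝 (e x), s ∈ e.target := e.open_target.mem_nhds (e.map_source hx)
  have key : ∀ s, s ∈ e.target → ContinuousAt f (e.symm s) → ContinuousAt (f ∘ e.symm) s :=
    fun s hs hc => hc.comp (e.continuousAt_symm hs)
  obtain ⟨h1, h2⟩ := (eventually_nhdsNE_iff_sides e hx).1 hf
  obtain ⟨r, hr⟩ := exists_tendsto_nhdsGT (h := f ∘ e.symm) (t := e x) (by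
    filter_upwards [h2, htarget.filter_mono nhdsWithin_le_nhds] with s h h' using key s h' h)
  by_cases h0 : e x = 0
  · refine ⟨0, r, ?_, hr, fun _ => rfl⟩
    rw [h0, NNReal.nhdsLT_zero]
    exact tendsto_bot
  · obtain ⟨l, hl⟩ := exists_tendsto_nhdsLT (h := f ∘ e.symm) h0 (by
      filter_upwards [h1, htarget.filter_mono nhdsWithin_le_nhds] with s h h' using key s h' h)
    exact ⟨l, r, hl, hr, fun h => absurd h h0⟩

/-- Invariance of the boundary in dimension one. -/
theorem chart_eq_zero_of_chart_eq_zero {e e' : OpenPartialHomeomorph X ℝ≥0} {x : X}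
    (hx : x ∈ e.source) (hx' : x ∈ e'.source) (h0 : e x = 0) : e' x = 0 := by
  by_contra hne
  have := NNReal.nhdsLT_neBot hne
  classical
  -- A step function jumping at `e' x`. Seen in `e`, the point `x` has only one side, so `k ∘ e'`
  -- has a single punctured limit there; seen in `e'`, its two one-sided limits differ.
  set k : ℝ≥0 → ZMod 2 := fun s => if e' x < s then 1 else 0 with hk
  have hkl : Tendsto k (𝓝[<] (e' x)) (𝓝 0) := tendsto_nhds_of_eventually_eq (by
    filter_upwards [self_mem_nhdsWithin] with s hs
    simp [hk, (show s < e' x from hs).le])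
  have hkr : Tendsto k (𝓝[>] (e' x)) (𝓝 1) := tendsto_nhds_of_eventually_eq (by
    filter_upwards [self_mem_nhdsWithin] with s hs
    simp [hk, show e' x < s from hs])
  have hkc : ∀ s, s ≠ e' x → ContinuousAt k s := by
    intro s hs
    rcases lt_or_gt_of_ne hs with h | h
    · exact (continuousAt_const (y := (0 : ZMod 2))).congr (by
        filter_upwards [Iio_mem_nhds h] with z hz
        simp [hk, (show z < e' x from hz).le])
    · exact (continuousAt_const (y := (1 : ZMod 2))).congr (by
        filter_upwards [Ioi_mem_nhds h] with z hz
        simp [hk, show e' x < z from hz])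
  have hf : ∀ᶠ y in 𝓝[≠] x, ContinuousAt (k ∘ e') y := by
    have hs : ∀ᶠ y in 𝓝 x, y ∈ e'.source := e'.open_source.mem_nhds hx'
    filter_upwards [hs.filter_mono nhdsWithin_le_nhds, self_mem_nhdsWithin] with y hy hyx
    exact (hkc _ fun h => hyx (e'.injOn hy hx' h)).comp (e'.continuousAt hy)
  obtain ⟨l, r, H⟩ := exists_hasSideLimits e hx hf
  have hlim : Tendsto (k ∘ e') (𝓝[≠] x) (𝓝 r) := by
    refine (tendsto_nhdsNE_iff_sides e hx).2 ⟨?_, H.right⟩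
    rw [h0, NNReal.nhdsLT_zero]
    exact tendsto_bot
  obtain ⟨hl, hr⟩ := (tendsto_nhdsNE_iff_sides e' hx').1 hlim
  have hinv : ∀ᶠ s in 𝓝 (e' x), k s = ((k ∘ e') ∘ e'.symm) s := by
    filter_upwards [e'.open_target.mem_nhds (e'.map_source hx')] with s hs
    simp [e'.right_inv hs]
  have h1 := tendsto_nhds_unique (hkl.congr' (hinv.filter_mono nhdsWithin_le_nhds)) hl
  have h2 := tendsto_nhds_unique (hkr.congr' (hinv.filter_mono nhdsWithin_le_nhds)) hr
  exact zero_ne_one (h1.trans h2.symm)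

/-- Every point of `X` has a chart to the half-line, in which `B` corresponds to `0`. -/
def HasHalfLineCharts (B : Set X) : Prop :=
  ∀ x, ∃ e : OpenPartialHomeomorph X ℝ≥0, x ∈ e.source ∧ ∀ y ∈ e.source, y ∈ B ↔ e y = 0

open Classical in
/-- The sum of the one-sided limits of `f` at `x`: there is one side if `x` lies in the boundary
`B`, and there are two sides otherwise. -/
noncomputable def sideSum (B : Set X) (f : X → ZMod 2) (x : X) : ZMod 2 :=
  if x ∈ B then if Tendsto f (𝓝[≠] x) (𝓝 1) then 1 else 0
  else if ∃ c, Tendsto f (𝓝[≠] x) (𝓝 c) then 0 else 1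

theorem ZMod.add_eq_ite_two (l r : ZMod 2) : l + r = if l = r then 0 else 1 := by
  revert l r; decide

theorem ZMod.eq_ite_two (r : ZMod 2) : r = if r = 1 then 1 else 0 := by
  revert r; decide

/-- Links the chart-free definition to charts. In `ZMod 2`, `l + r = 0` iff `l = r`, that is, iff
the punctured limit exists; at a boundary point the left filter is `⊥` and only `r` matters. -/
theorem sideSum_eq {B : Set X} {f : X → ZMod 2} {e : OpenPartialHomeomorph X ℝ≥0} {x : X}
    (hx : x ∈ e.source) (hB : x ∈ B ↔ e x = 0) {l r : ZMod 2}
    (H : HasSideLimits (f ∘ e.symm) (e x) l r) : sideSum B f x = l + r := by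
  have hr : ∀ c, Tendsto (f ∘ e.symm) (𝓝[>] (e x)) (𝓝 c) ↔ r = c :=
    fun c => ⟨tendsto_nhds_unique H.right, fun h => h ▸ H.right⟩
  by_cases h : x ∈ B
  · have h0 := hB.1 h
    have : Tendsto (f ∘ e.symm) (𝓝[<] (e x)) (𝓝 1) := by
      rw [h0, NNReal.nhdsLT_zero]
      exact tendsto_bot
    rw [sideSum, if_pos h, H.left_zero h0, zero_add]
    simp only [tendsto_nhdsNE_iff_sides e hx, hr, this, true_and]
    exact (ZMod.eq_ite_two r).symm
  · have := NNReal.nhdsLT_neBot fun h0 => h (hB.2 h0)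
    have hl : ∀ c, Tendsto (f ∘ e.symm) (𝓝[<] (e x)) (𝓝 c) ↔ l = c :=
      fun c => ⟨tendsto_nhds_unique H.left, fun h => h ▸ H.left⟩
    rw [sideSum, if_neg h, ZMod.add_eq_ite_two]
    simp only [tendsto_nhdsNE_iff_sides e hx, hr, hl]
    congr 1
    simp [eq_comm]

theorem sideSum_add {B : Set X} (hB : HasHalfLineCharts B) {f g : X → ZMod 2} (hf : IsTame f)
    (hg : IsTame g) (x : X) : sideSum B (f + g) x = sideSum B f x + sideSum B g x := by
  obtain ⟨e, hx, he⟩ := hB x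
  obtain ⟨l, r, H⟩ := exists_hasSideLimits e hx (hf x)
  obtain ⟨l', r', K⟩ := exists_hasSideLimits e hx (hg x)
  rw [sideSum_eq hx (he x hx) H, sideSum_eq hx (he x hx) K,
    sideSum_eq (f := f + g) hx (he x hx) (H.add K)]
  ring

theorem sideSum_of_continuousAt {B : Set X} {f : X → ZMod 2} {x : X} (hx : x ∉ B)
    (hf : ContinuousAt f x) : sideSum B f x = 0 := by
  rw [sideSum, if_neg hx, if_pos ⟨f x, hf.mono_left nhdsWithin_le_nhds⟩]

theorem HasHalfLineCharts.nhdsNE_neBot {B : Set X} (hB : HasHalfLineCharts B) (x : X) :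
    (𝓝[≠] x).NeBot := by
  obtain ⟨e, hx, -⟩ := hB x
  rw [← e.symm_map_nhdsNE hx, map_neBot_iff, ← nhdsLT_sup_nhdsGT]
  exact sup_neBot.2 (Or.inr inferInstance)

theorem sideSum_of_mem_boundary {B : Set X} (hB : HasHalfLineCharts B) {f : X → ZMod 2} {x : X}
    (hx : x ∈ B) (hf : ContinuousAt f x) : sideSum B f x = f x := by
  have := hB.nhdsNE_neBot x
  have hfx : Tendsto f (𝓝[≠] x) (𝓝 (f x)) := hf.mono_left nhdsWithin_le_nhds
  have : Tendsto f (𝓝[≠] x) (𝓝 1) ↔ f x = 1 :=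
    ⟨tendsto_nhds_unique hfx, fun h => h ▸ hfx⟩
  rw [sideSum, if_pos hx]
  simp only [this]
  exact (ZMod.eq_ite_two _).symm

/-- A chart is injective, so its source contains at most one point of `B`. This gives both the
finiteness of `B` in compact sets and the discreteness of the faces. -/
theorem HasHalfLineCharts.eventually_notMem {B : Set X} (hB : HasHalfLineCharts B) (x : X) :
    ∀ᶠ y in 𝓝[≠] x, y ∉ B := by
  obtain ⟨e, hx, he⟩ := hB x
  have hs : ∀ᶠ y in 𝓝 x, y ∈ e.source := e.open_source.mem_nhds hx
  by_cases h0 : e x = 0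
  · filter_upwards [hs.filter_mono nhdsWithin_le_nhds, self_mem_nhdsWithin] with y hy hyx hyB
    exact hyx (e.injOn hy hx (((he y hy).1 hyB).trans h0.symm))
  · have h1 : ∀ᶠ y in 𝓝 x, e y ≠ 0 := (e.continuousAt hx).eventually_ne h0
    filter_upwards [(hs.and h1).filter_mono nhdsWithin_le_nhds] with y hy hyB
    exact hy.2 ((he y hy.1).1 hyB)

theorem eventually_sideSum_eq_zero {B : Set X} (hB : HasHalfLineCharts B) {f : X → ZMod 2}
    (hf : IsTame f) (x : X) : ∀ᶠ y in 𝓝[≠] x, sideSum B f y = 0 := by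
  filter_upwards [hf x, hB.eventually_notMem x] with y h1 h2 using sideSum_of_continuousAt h2 h1

/-- A subset of a compact set that accumulates nowhere is finite. -/
theorem IsCompact.finite_of_eventually_notMem {K S : Set X} (hK : IsCompact K) (hS : S ⊆ K)
    (h : ∀ x, ∀ᶠ y in 𝓝[≠] x, y ∉ S) : S.Finite := by
  obtain ⟨t, -, ht⟩ := hK.elim_nhds_subcover (fun x => {y | y ≠ x → y ∉ S})
    fun x _ => eventually_nhdsWithin_iff.1 (h x)
  refine t.finite_toSet.subset fun y hy => ?_
  obtain ⟨x, hxt, hxy⟩ := mem_iUnion₂.1 (ht (hS hy))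
  by_contra hyt
  exact hxy (fun hyx => hyt (hyx ▸ hxt)) hy

end Sides

/-! ### The computation on the half-line -/

/-- The one-sided limits of a compactly supported function on the half-line add up to zero. -/
theorem finsum_sideLimits_eq_zero {h l r : ℝ≥0 → ZMod 2}
    (H : ∀ t, HasSideLimits h t (l t) (r t)) {b : ℝ≥0} (hb : ∀ t, b < t → h t = 0) :
    ∑ᶠ t, (l t + r t) = 0 := by
  -- Just to the right of `t` the function is constant, so both limits at each nearby `v` equal `r
  -- t` and cancel mod 2.
  have hr : ∀ t, ∀ᶠ v in 𝓝[>] t, l v = r t ∧ r v = r t := by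
    intro t
    have h1 : ∀ᶠ v in 𝓝[>] t, h v = r t := by
      simpa [nhds_discrete] using (H t).right
    obtain ⟨u, hu, hsub⟩ := mem_nhdsGT_iff_exists_Ioo_subset.1 h1
    filter_upwards [Ioo_mem_nhdsGT (show t < u from hu)] with v hv
    have := NNReal.nhdsLT_neBot (pos_of_gt hv.1).ne'
    have h2 : ∀ᶠ w in 𝓝 v, h w = r t :=
      (Ioo_mem_nhds hv.1 hv.2 : Ioo t u ∈ 𝓝 v) |> fun hm => mem_of_superset hm hsub
    exact ⟨tendsto_nhds_unique (H v).left
        (tendsto_nhds_of_eventually_eq (h2.filter_mono nhdsWithin_le_nhds)),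
      tendsto_nhds_unique (H v).right
        (tendsto_nhds_of_eventually_eq (h2.filter_mono nhdsWithin_le_nhds))⟩
  have hl : ∀ t, ∀ᶠ v in 𝓝[<] t, l v = l t ∧ r v = l t := by
    intro t
    rcases eq_or_ne t 0 with rfl | ht
    · simp
    have h1 : ∀ᶠ v in 𝓝[<] t, h v = l t := by
      simpa [nhds_discrete] using (H t).left
    obtain ⟨u, hu, hsub⟩ := (mem_nhdsLT_iff_exists_Ioo_subset' (pos_iff_ne_zero.2 ht)).1 h1
    filter_upwards [Ioo_mem_nhdsLT (show u < t from hu)] with v hv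
    have := NNReal.nhdsLT_neBot (pos_of_gt hv.1).ne'
    have h2 : ∀ᶠ w in 𝓝 v, h w = l t :=
      (Ioo_mem_nhds hv.1 hv.2 : Ioo u t ∈ 𝓝 v) |> fun hm => mem_of_superset hm hsub
    exact ⟨tendsto_nhds_unique (H v).left
        (tendsto_nhds_of_eventually_eq (h2.filter_mono nhdsWithin_le_nhds)),
      tendsto_nhds_unique (H v).right
        (tendsto_nhds_of_eventually_eq (h2.filter_mono nhdsWithin_le_nhds))⟩
  set s : ℝ≥0 → ZMod 2 := fun t => l t + r t with hs
  have hs0 : ∀ t, b < t → l t = 0 ∧ r t = 0 := by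
    intro t ht
    have := NNReal.nhdsLT_neBot (pos_of_gt ht).ne'
    have h2 : ∀ᶠ w in 𝓝 t, h w = 0 := by
      filter_upwards [Ioi_mem_nhds ht] with w hw using hb w hw
    exact ⟨tendsto_nhds_unique (H t).left
        (tendsto_nhds_of_eventually_eq (h2.filter_mono nhdsWithin_le_nhds)),
      tendsto_nhds_unique (H t).right
        (tendsto_nhds_of_eventually_eq (h2.filter_mono nhdsWithin_le_nhds))⟩
  have hfin : (Function.support s).Finite := by
    refine (isCompact_Icc (a := 0) (b := b)).finite_of_eventually_notMem ?_ fun t => ?_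
    · intro t ht
      refine ⟨zero_le, not_lt.1 fun hbt => ht ?_⟩
      simp [hs, hs0 t hbt]
    · rw [← nhdsLT_sup_nhdsGT, eventually_sup]
      constructor
      · filter_upwards [hl t] with v hv
        simp [hs, hv, CharTwo.add_self_eq_zero]
      · filter_upwards [hr t] with v hv
        simp [hs, hv, CharTwo.add_self_eq_zero]
  set S := hfin.toFinset with hS
  have hSs : ∀ t, s t ≠ 0 → t ∈ S := fun t ht => hfin.mem_toFinset.2 ht
  -- All side sums before `u`, plus the left limit at `u`. Passing `u` adds `l u + r u` to the sum
  -- and replaces `l u` by `r u`, which changes nothing mod 2; hence `φ` is constant.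
  set φ : ℝ≥0 → ZMod 2 := fun u => ∑ t ∈ S with t < u, s t + l u with hφ
  have hright : ∀ u, ∀ᶠ v in 𝓝[>] u, φ v = φ u := by
    intro u
    obtain ⟨w, hw, hsub⟩ := mem_nhdsGT_iff_exists_Ioo_subset.1 (hr u)
    filter_upwards [Ioo_mem_nhdsGT (show u < w from hw)] with v hv
    have h1 : ∑ t ∈ S with t < v, s t = ∑ t ∈ S with t < u, s t + s u := by
      -- The index sets may differ by points strictly between `u` and `v`, or by `u` itself when `u
      -- ∉ S`; `s` vanishes at all of these.
      have : ∑ t ∈ S with t < v, s t = ∑ t ∈ insert u ({t ∈ S | t < u}), s t := by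
        refine Finset.sum_congr_of_eq_on_inter ?_ ?_ fun _ _ _ => rfl
        · intro t ht ht'
          simp only [Finset.mem_filter, Finset.mem_insert, not_or, not_and, not_lt] at ht ht'
          have hut : u < t := lt_of_le_of_ne (ht'.2 ht.1) (Ne.symm ht'.1)
          obtain ⟨h1, h2⟩ := hsub ⟨hut, ht.2.trans hv.2⟩
          simp [hs, h1, h2, CharTwo.add_self_eq_zero]
        · intro t ht ht'
          simp only [Finset.mem_filter, Finset.mem_insert, not_and, not_lt] at ht ht'
          by_contra h0
          have := ht' (hSs t h0)
          rcases ht with rfl | ht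
          · exact absurd hv.1 (not_lt.2 this)
          · exact absurd (ht.2.trans hv.1) (not_lt.2 this)
      rw [this, Finset.sum_insert (by simp), add_comm]
    have h2 := (hsub hv).1
    simp only [hφ]
    rw [h1, h2, show s u = l u + r u from rfl, add_assoc, add_assoc, CharTwo.add_self_eq_zero,
      add_zero]
  have hleft : ∀ u, ∀ᶠ v in 𝓝[<] u, φ v = φ u := by
    intro u
    rcases eq_or_ne u 0 with rfl | hu0
    · simp
    obtain ⟨w, hw, hsub⟩ := (mem_nhdsLT_iff_exists_Ioo_subset' (pos_iff_ne_zero.2 hu0)).1 (hl u)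
    filter_upwards [Ioo_mem_nhdsLT (show w < u from hw)] with v hv
    have h1 : ∑ t ∈ S with t < v, s t = ∑ t ∈ S with t < u, s t := by
      refine Finset.sum_subset (fun t ht => ?_) fun t ht ht' => ?_
      · simp only [Finset.mem_filter] at ht ⊢
        exact ⟨ht.1, ht.2.trans hv.2⟩
      · simp only [Finset.mem_filter, not_and, not_lt] at ht ht'
        obtain ⟨h1, h2⟩ := hsub ⟨hv.1.trans_le (ht' ht.1), ht.2⟩
        simp [hs, h1, h2, CharTwo.add_self_eq_zero]
    simp only [hφ, h1, (hsub hv).1]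
  have hconst : IsLocallyConstant φ := by
    refine (IsLocallyConstant.iff_eventually_eq φ).2 fun u => ?_
    have h1 : ∀ᶠ v in 𝓝[≠] u, φ v = φ u := by
      rw [← nhdsLT_sup_nhdsGT, eventually_sup]
      exact ⟨hleft u, hright u⟩
    rw [← nhdsNE_sup_pure, eventually_sup]
    exact ⟨h1, by simp⟩
  have h0 : φ 0 = 0 := by
    simp [hφ, (H 0).left_zero rfl]
  -- Beyond `b` the left limit is zero and every jump has been counted.
  have hend : φ (b + 1) = ∑ᶠ t, s t := by
    have hlt : b < b + 1 := lt_add_of_pos_right b one_pos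
    rw [finsum_eq_sum_of_support_subset s (s := S) (by simp [hS])]
    simp only [hφ, (hs0 _ hlt).1, add_zero]
    refine Finset.sum_subset (Finset.filter_subset _ _) fun t _ ht' => ?_
    by_contra hne
    have hbt : b < t := hlt.trans_le (not_lt.1 fun hlt' =>
      ht' (Finset.mem_filter.2 ⟨hSs t hne, hlt'⟩))
    simp [hs, hs0 t hbt] at hne
  rw [← hend, ← h0]
  exact hconst.apply_eq_of_preconnectedSpace _ _

/-! ### Compactly supported functions, by cutting into arcs -/

section CompactSupport

variable {X : Type*} [TopologicalSpace X] {B : Set X}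

theorem sideSum_eq_zero_of_eventually (hB : HasHalfLineCharts B) {f : X → ZMod 2} {x : X}
    (hf : ∀ᶠ y in 𝓝 x, f y = 0) : sideSum B f x = 0 := by
  have hc : ContinuousAt f x := by
    have h0 : f x = 0 := hf.self_of_nhds
    rw [ContinuousAt, h0]
    exact tendsto_nhds_of_eventually_eq hf
  by_cases hx : x ∈ B
  · rw [sideSum_of_mem_boundary hB hx hc, hf.self_of_nhds]
  · exact sideSum_of_continuousAt hx hc

theorem sideSum_eq_zero_of_notMem (hB : HasHalfLineCharts B) {f : X → ZMod 2} {K : Set X}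
    (hK : IsClosed K) (h0 : ∀ x ∉ K, f x = 0) {x : X} (hx : x ∉ K) : sideSum B f x = 0 :=
  sideSum_eq_zero_of_eventually hB (mem_of_superset (hK.isOpen_compl.mem_nhds hx) h0)

theorem support_sideSum_finite [T2Space X] (hB : HasHalfLineCharts B) {f : X → ZMod 2}
    (hf : IsTame f) {K : Set X} (hK : IsCompact K) (h0 : ∀ x ∉ K, f x = 0) :
    (Function.support (sideSum B f)).Finite := by
  refine hK.finite_of_eventually_notMem (fun x hx => ?_) fun x => ?_
  · by_contra hxK
    exact hx (sideSum_eq_zero_of_notMem hB hK.isClosed h0 hxK)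
  · filter_upwards [eventually_sideSum_eq_zero hB hf x] with y hy
    simp [hy]

theorem isCompact_arc (e : OpenPartialHomeomorph X ℝ≥0) {a b : ℝ≥0} (hab : Icc a b ⊆ e.target) :
    IsCompact (e.symm '' Icc a b) :=
  isCompact_Icc.image_of_continuousOn (e.continuousOn_symm.mono hab)

/-- Transport to the half-line through `e` and extend by zero. -/
theorem finsum_sideSum_eq_zero_of_arc [T2Space X] (hB : HasHalfLineCharts B) {f : X → ZMod 2}
    (hf : IsTame f) (e : OpenPartialHomeomorph X ℝ≥0) (he : ∀ y ∈ e.source, y ∈ B ↔ e y = 0)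
    {a b : ℝ≥0} (hab : Icc a b ⊆ e.target) (h0 : ∀ x ∉ e.symm '' Icc a b, f x = 0) :
    ∑ᶠ x, sideSum B f x = 0 := by
  set h : ℝ≥0 → ZMod 2 := (Icc a b).indicator (f ∘ e.symm) with hh
  -- Agreement on the whole open target, not only on `Icc a b`, makes the side limits at `a` and `b`
  -- those of `f`.
  have heq : ∀ t ∈ e.target, h t = f (e.symm t) := by
    intro t ht
    by_cases htI : t ∈ Icc a b
    · rw [hh, indicator_of_mem htI, Function.comp_apply]
    · rw [hh, indicator_of_notMem htI, h0]
      rintro ⟨s, hs, hst⟩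
      exact htI (e.symm.injOn (hab hs) ht hst ▸ hs)
  have hsym : ∀ t ∈ Icc a b, e.symm t ∈ e.source := fun t ht => e.map_target (hab ht)
  have H : ∀ t, ∃ l r, HasSideLimits h t l r := by
    intro t
    by_cases ht : t ∈ Icc a b
    · obtain ⟨l, r, H⟩ := exists_hasSideLimits e (hsym t ht) (hf _)
      rw [e.right_inv (hab ht)] at H
      refine ⟨l, r, H.congr ?_⟩
      filter_upwards [e.open_target.mem_nhds (hab ht)] with s hs
      rw [heq s hs, Function.comp_apply]
    · refine ⟨0, 0, (hasSideLimits_zero t).congr ?_⟩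
      filter_upwards [isClosed_Icc.isOpen_compl.mem_nhds ht] with s hs
      exact (indicator_of_notMem hs _).symm
  choose l r H using H
  have hside : ∀ t ∈ Icc a b, sideSum B f (e.symm t) = l t + r t := by
    intro t ht
    refine sideSum_eq (hsym t ht) (he _ (hsym t ht)) ?_
    rw [e.right_inv (hab ht)]
    refine (H t).congr ?_
    filter_upwards [e.open_target.mem_nhds (hab ht)] with s hs using heq s hs
  have hzero : ∀ t ∉ Icc a b, l t + r t = 0 := by
    intro t ht
    have h1 : ∀ᶠ s in 𝓝 t, h s = 0 := by
      filter_upwards [isClosed_Icc.isOpen_compl.mem_nhds ht] with s hs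
      exact indicator_of_notMem hs _
    have hr : r t = 0 := tendsto_nhds_unique (H t).right
      (tendsto_nhds_of_eventually_eq (h1.filter_mono nhdsWithin_le_nhds))
    have hl : l t = 0 := by
      by_cases ht0 : t = 0
      · exact (H t).left_zero ht0
      · have := NNReal.nhdsLT_neBot ht0
        exact tendsto_nhds_unique (H t).left
          (tendsto_nhds_of_eventually_eq (h1.filter_mono nhdsWithin_le_nhds))
    rw [hl, hr, add_zero]
  calc ∑ᶠ x, sideSum B f x = ∑ᶠ x ∈ e.symm '' Icc a b, sideSum B f x := by
        rw [finsum_mem_def, indicator_eq_self.2]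
        intro x hx
        by_contra hxK
        exact hx (sideSum_eq_zero_of_notMem hB (isCompact_arc e hab).isClosed h0 hxK)
    _ = ∑ᶠ t ∈ Icc a b, sideSum B f (e.symm t) := finsum_mem_image (e.symm.injOn.mono hab)
    _ = ∑ᶠ t ∈ Icc a b, (l t + r t) := finsum_mem_congr rfl hside
    _ = ∑ᶠ t, (l t + r t) := by
        rw [finsum_mem_def, indicator_eq_self.2]
        intro t ht
        by_contra htI
        exact ht (hzero t htI)
    _ = 0 := finsum_sideLimits_eq_zero H (b := b) fun t ht =>
        indicator_of_notMem (fun h => not_lt.2 h.2 ht) _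

/-- Ensures that cutting along an arc preserves tameness. Only an inclusion: if `a = 0` and `0 < b`,
the point `e.symm a` is interior to the arc. -/
theorem frontier_arc_subset [T2Space X] (e : OpenPartialHomeomorph X ℝ≥0) {a b : ℝ≥0}
    (hab : Icc a b ⊆ e.target) : frontier (e.symm '' Icc a b) ⊆ {e.symm a, e.symm b} := by
  rintro x ⟨hx, hxi⟩
  rw [(isCompact_arc e hab).isClosed.closure_eq] at hx
  obtain ⟨t, ht, rfl⟩ := hx
  by_contra hne
  simp only [mem_insert_iff, mem_singleton_iff, not_or] at hne
  have h1 : a < t := lt_of_le_of_ne ht.1 fun h => hne.1 (h ▸ rfl)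
  have h2 : t < b := lt_of_le_of_ne ht.2 fun h => hne.2 (h ▸ rfl)
  exact hxi (mem_interior_iff_mem_nhds.2
    (e.symm.image_mem_nhds (hab ht) (Icc_mem_nhds h1 h2)))

/-- Away from the frontier of `A`, the indicator agrees locally with `f` or with `0`. -/
theorem IsTame.indicator [T1Space X] {f : X → ZMod 2} (hf : IsTame f) {A : Set X}
    (hA : (frontier A).Finite) : IsTame (A.indicator f) := by
  intro x
  have h1 : ∀ᶠ y in 𝓝[≠] x, y ∉ frontier A := by
    have h2 : (frontier A \ {x})ᶜ ∈ 𝓝 x :=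
      (hA.subset sdiff_subset).isClosed.isOpen_compl.mem_nhds (by simp)
    filter_upwards [nhdsWithin_le_nhds h2, self_mem_nhdsWithin] with y hy hyx hyA
    exact hy ⟨hyA, hyx⟩
  filter_upwards [hf x, h1] with y hy hyA
  by_cases hyi : y ∈ A
  · have : A ∈ 𝓝 y := by
      by_contra h
      exact hyA ⟨subset_closure hyi, fun h' => h (mem_interior_iff_mem_nhds.1 h')⟩
    exact hy.congr (mem_of_superset this fun z hz => (indicator_of_mem hz f).symm)
  · have : Aᶜ ∈ 𝓝 y := by
      by_contra h
      rw [← frontier_compl] at hyA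
      exact hyA ⟨subset_closure hyi, fun h' => h (mem_interior_iff_mem_nhds.1 h')⟩
    exact (continuousAt_const (y := (0 : ZMod 2))).congr
      (mem_of_superset this fun z hz => (indicator_of_notMem hz f).symm)

/-- The one-sided limits of a tame function with compact support add up to zero. -/
theorem finsum_sideSum_eq_zero [T2Space X] (hB : HasHalfLineCharts B) {f : X → ZMod 2}
    (hf : IsTame f) {K : Set X} (hK : IsCompact K) (h0 : ∀ x ∉ K, f x = 0) :
    ∑ᶠ x, sideSum B f x = 0 := by
  have harc : ∀ x, ∃ A ∈ 𝓝 x, (frontier A).Finite ∧ ∀ g : X → ZMod 2, IsTame g →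
      (∀ y ∉ A, g y = 0) → ∑ᶠ y, sideSum B g y = 0 := by
    intro x
    obtain ⟨e, hx, he⟩ := hB x
    obtain ⟨a, b, -, hmem, hab⟩ := exists_Icc_mem_subset_of_mem_nhds
      (e.open_target.mem_nhds (e.map_source hx))
    refine ⟨e.symm '' Icc a b, ?_, (toFinite _).subset (frontier_arc_subset e hab),
      fun g hg hg0 => finsum_sideSum_eq_zero_of_arc hB hg e he hab hg0⟩
    simpa [e.left_inv hx] using e.symm.image_mem_nhds (e.map_source hx) hmem
  choose A hA hfr hsum using harc
  obtain ⟨t, -, ht⟩ := hK.elim_nhds_subcover A fun x _ => hA x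
  -- The induction removes arcs from the support of a varying `f`; `K` stays fixed and keeps the
  -- sums finite.
  replace ht : ∀ x ∉ ⋃ i ∈ t, A i, f x = 0 := fun x hx => h0 x fun hxK => hx (ht hxK)
  classical
  induction t using Finset.induction_on generalizing f with
  | empty =>
    have hf0 : ∀ x, f x = 0 := fun x => ht x (by simp)
    rw [finsum_congr fun x => sideSum_eq_zero_of_eventually hB (Eventually.of_forall hf0)]
    exact finsum_zero
  | insert i t _ ih =>
    have h1 : IsTame ((A i).indicator f) := hf.indicator (hfr i)
    have h2 : IsTame ((A i)ᶜ.indicator f) := hf.indicator (by rw [frontier_compl]; exact hfr i)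
    have h10 : ∀ x ∉ K, (A i).indicator f x = 0 := fun x hx => by simp [indicator, h0 x hx]
    have h20 : ∀ x ∉ K, (A i)ᶜ.indicator f x = 0 := fun x hx => by simp [indicator, h0 x hx]
    -- The first summand lives on a single arc, the second on the remaining ones.
    have hadd : ∀ x, sideSum B f x =
        sideSum B ((A i).indicator f) x + sideSum B ((A i)ᶜ.indicator f) x := fun x => by
      rw [← sideSum_add hB h1 h2, indicator_self_add_compl]
    rw [finsum_congr hadd, finsum_add_distrib (support_sideSum_finite hB h1 hK h10)
      (support_sideSum_finite hB h2 hK h20), ih h2 h20, add_zero]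
    · exact hsum i _ h1 fun y hy => indicator_of_notMem hy f
    · intro x hx
      by_cases hxi : x ∈ A i
      · exact indicator_of_notMem (by simpa using hxi) f
      · rw [indicator_of_mem (by simpa using hxi)]
        refine ht x fun hx' => ?_
        rw [Finset.set_biUnion_insert] at hx'
        exact hx'.elim hxi hx

/-- A compact open subset of a one-dimensional manifold has an even number of boundary points. -/
theorem ncard_boundary_inter_eq_zero [T2Space X] (hB : HasHalfLineCharts B) {K : Set X}
    (hK : IsCompact K) (hKo : IsOpen K) : ((B ∩ K).ncard : ZMod 2) = 0 := by
  classical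
  have hc : ∀ x, ContinuousAt (K.indicator (1 : X → ZMod 2)) x := fun x =>
    ((show IsClopen K from ⟨hK.isClosed, hKo⟩).continuous_indicator continuous_const).continuousAt
  have h := finsum_sideSum_eq_zero hB (f := K.indicator 1)
    (fun x => Eventually.of_forall hc) hK fun x hx => indicator_of_notMem hx _
  have hfin : (B ∩ K).Finite := hK.finite_of_eventually_notMem inter_subset_right fun x =>
    (hB.eventually_notMem x).mono fun y hy h => hy h.1
  -- The indicator of a clopen set is continuous, so interior points contribute `0` and boundary
  -- points contribute its value.
  have hs : ∀ x, sideSum B (K.indicator 1) x = (B ∩ K).indicator 1 x := by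
    intro x
    by_cases hx : x ∈ B
    · rw [sideSum_of_mem_boundary hB hx (hc x)]
      by_cases hxK : x ∈ K <;> simp [hx, hxK]
    · rw [sideSum_of_continuousAt hx (hc x)]
      simp [hx]
  rw [finsum_congr hs, ← finsum_mem_def, finsum_mem_eq_finite_toFinset_sum _ hfin] at h
  rw [ncard_eq_toFinset_card _ hfin]
  simpa using h

end CompactSupport

/-! ### Half-spaces and manifolds of dimension 0 and 1 -/

/-- The one-dimensional half-space is the half-line. -/
def HalfSpace.homeomorphNNReal : HalfSpace 1 ≃ₜ ℝ≥0 where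
  toFun v := ⟨v.1 0, v.2 0 rfl⟩
  invFun t := ⟨fun _ => t, fun _ _ => t.2⟩
  left_inv v := by
    ext j
    rw [Subsingleton.elim j 0]
    rfl
  right_inv t := rfl
  continuous_toFun := by
    refine Continuous.subtype_mk ?_ _
    exact (continuous_apply 0).comp continuous_subtype_val
  continuous_invFun := by
    refine Continuous.subtype_mk ?_ _
    exact continuous_pi fun _ => NNReal.continuous_coe

theorem HalfSpace.homeomorphNNReal_eq_zero_iff {v : HalfSpace 1} :
    homeomorphNNReal v = 0 ↔ v ∈ HalfSpace.boundary 1 := by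
  constructor
  · exact fun h => ⟨0, rfl, congrArg NNReal.toReal h⟩
  · rintro ⟨j, -, hj⟩
    rw [Subsingleton.elim j 0] at hj
    exact NNReal.coe_injective hj

theorem HalfSpace.not_isOpen_singleton {n : ℕ} (hn : n ≠ 0) (v : HalfSpace n) :
    ¬ IsOpen ({v} : Set (HalfSpace n)) := by
  intro h
  -- The diagonal ray from `v` stays in the half-space and returns to `v` only at `0`, so an open
  -- `{v}` would isolate `0` in `ℝ≥0`.
  let γ : ℝ≥0 → HalfSpace n := fun s => ⟨fun j => v.1 j + s, fun j hj => add_nonneg (v.2 j hj) s.2⟩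
  have hγ : Continuous γ := by
    refine Continuous.subtype_mk (continuous_pi fun j => ?_) _
    exact continuous_const.add NNReal.continuous_coe
  have hpre : γ ⁻¹' {v} = {0} := by
    ext s
    simp only [mem_preimage, mem_singleton_iff, γ, Subtype.ext_iff, funext_iff]
    refine ⟨fun hs => ?_, fun hs j => by simp [hs]⟩
    simpa using hs ⟨0, Nat.pos_of_ne_zero hn⟩
  have h0 := h.preimage hγ
  rw [hpre] at h0
  exact (NeBot.ne inferInstance : 𝓝[≠] (0 : ℝ≥0) ≠ ⊥) ((isOpen_singleton_iff_punctured_nhds _).1 h0)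

namespace C0Manifold

theorem boundary_eq_empty {Y : Type*} [TopologicalSpace Y] [C0Manifold Y]
    (hY : HasDimension Y 0) : boundary Y = ∅ := by
  refine eq_empty_of_forall_notMem ?_
  rintro y ⟨n, e, he, hy, j, -⟩
  have hn : n = 0 := (dim_eq_of_mem_source n e he y hy).symm.trans (hY y)
  subst hn
  exact j.elim0

theorem interior_eq_univ {Y : Type*} [TopologicalSpace Y] [C0Manifold Y]
    (hY : HasDimension Y 0) : interior Y = univ := by
  rw [interior, boundary_eq_empty hY, compl_empty]

theorem hasDimension_zero_of_discreteTopology (Y : Type*) [TopologicalSpace Y] [C0Manifold Y]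
    [DiscreteTopology Y] : HasDimension Y 0 := by
  intro y
  by_contra hn
  obtain ⟨e, -, hy⟩ := exists_chart y
  refine HalfSpace.not_isOpen_singleton hn (e y) ?_
  rw [← image_singleton]
  exact e.isOpen_image_of_subset_source (isOpen_discrete _) (singleton_subset_iff.2 hy)

theorem hasHalfLineCharts {X : Type*} [TopologicalSpace X] [C0Manifold X]
    (hX : HasDimension X 1) : HasHalfLineCharts (boundary X) := by
  intro x
  obtain ⟨e, he, hx⟩ : ∃ e ∈ charts (X := X) 1, x ∈ e.source := hX x ▸ exists_chart x
  refine ⟨e.transHomeomorph HalfSpace.homeomorphNNReal, hx, fun y hy => ⟨?_, fun h0 =>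
    ⟨1, e, he, hy, HalfSpace.homeomorphNNReal_eq_zero_iff.1 h0⟩⟩⟩
  rintro ⟨n, e', he', hy', hb⟩
  have hn : n = 1 := (dim_eq_of_mem_source n e' he' y hy').symm.trans (hX y)
  subst hn
  exact chart_eq_zero_of_chart_eq_zero (e := e'.transHomeomorph HalfSpace.homeomorphNNReal) hy' hy
    (HalfSpace.homeomorphNNReal_eq_zero_iff.2 hb)

end C0Manifold

theorem IsSystemOfBoundaryFaces.discreteTopology {X : Type*} [TopologicalSpace X] [C0Manifold X]
    (hX : C0Manifold.HasDimension X 1) {I : Type*} [Finite I] {F : I → Type*}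
    [∀ i, TopologicalSpace (F i)] [∀ i, C0Manifold (F i)] {φ : ∀ i, F i → X}
    (hφ : IsSystemOfBoundaryFaces φ) (i : I) : DiscreteTopology (F i) := by
  refine discreteTopology_iff_isOpen_singleton.2 fun y => ?_
  have h := (C0Manifold.hasHalfLineCharts hX).eventually_notMem (φ i y)
  rw [eventually_nhdsWithin_iff] at h
  have h' := (hφ.isEmbedding i).continuous.continuousAt.eventually h
  rw [isOpen_singleton_iff_nhds_eq_pure]
  refine le_antisymm (le_pure_iff.2 ?_) (pure_le_nhds y)
  filter_upwards [h'] with z hz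
  by_contra hzy
  exact hz (fun h => hzy ((hφ.isEmbedding i).injective h)) (hφ.range_subset i (mem_range_self z))

/-- The faces of a one-dimensional manifold cover its boundary. -/
theorem IsSystemOfBoundaryFaces.iUnion_range_eq {X : Type*} [TopologicalSpace X] [C0Manifold X]
    (hX : C0Manifold.HasDimension X 1) {I : Type*} [Finite I] {F : I → Type*}
    [∀ i, TopologicalSpace (F i)] [∀ i, C0Manifold (F i)] {φ : ∀ i, F i → X}
    (hφ : IsSystemOfBoundaryFaces φ) (h0 : ∀ i, C0Manifold.HasDimension (F i) 0) :
    ⋃ i, range (φ i) = C0Manifold.boundary X := by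
  refine (iUnion_subset hφ.range_subset).antisymm fun x hx => ?_
  have h := (C0Manifold.hasHalfLineCharts hX).eventually_notMem x
  have hcl := hφ.closure_eq
  simp only [C0Manifold.interior_eq_univ (h0 _), image_univ] at hcl
  rw [eventually_nhdsWithin_iff] at h
  have hx' := hx
  rw [← hcl] at hx'
  obtain ⟨y, hy, hyU⟩ := mem_closure_iff_nhds.1 hx' _ h
  by_contra hxU
  exact hy (fun hyx => hxU (mem_singleton_iff.1 hyx ▸ hyU)) (iUnion_subset hφ.range_subset hyU)

theorem mainTheorem3 {X : Type*} [TopologicalSpace X] [C0Manifold X]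
    (hX : C0Manifold.HasDimension X 1)
    {I : Type*} [Fintype I] {F : I → Type*} [∀ i, TopologicalSpace (F i)] [∀ i, C0Manifold (F i)]
    (φ : ∀ i, F i → X) (hφ : IsSystemOfBoundaryFaces φ)
    (E : X → ℝ) (hE : IsLocallyConstant E) (hcompact : ∀ c : ℝ, IsCompact (E ⁻¹' Set.Iic c)) :
    ∃ h : ∀ i, HasNovikovCount (E ∘ φ i), ∑ i, novikovCount (E ∘ φ i) (h i) = 0 := by
  have hB := C0Manifold.hasHalfLineCharts hX
  have h0 : ∀ i, C0Manifold.HasDimension (F i) 0 := fun i =>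
    have := hφ.discreteTopology hX i
    C0Manifold.hasDimension_zero_of_discreteTopology (F i)
  have hfin : ∀ i c, ((E ∘ φ i) ⁻¹' Iic c).Finite := by
    intro i c
    have hBc : (C0Manifold.boundary X ∩ E ⁻¹' Iic c).Finite :=
      (hcompact c).finite_of_eventually_notMem inter_subset_right fun x =>
        (hB.eventually_notMem x).mono fun y hy h => hy h.1
    refine (hBc.preimage ((hφ.isEmbedding i).injective.injOn)).subset fun y hy => ?_
    exact ⟨hφ.range_subset i (mem_range_self y), hy⟩
  have hlevel : ∀ i c, ((E ∘ φ i) ⁻¹' {c}).Finite := fun i c =>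
    (hfin i c).subset (preimage_mono (singleton_subset_iff.2 self_mem_Iic))
  refine ⟨fun i => ⟨h0 i, fun c => ?_, hlevel i⟩, ?_⟩
  · refine ((hfin i c).image (E ∘ φ i)).subset ?_
    rintro _ ⟨⟨y, rfl⟩, hy⟩
    exact ⟨y, hy, rfl⟩
  refine Subtype.ext (HahnSeries.ext (funext fun c => ?_))
  have hunion : C0Manifold.boundary X ∩ E ⁻¹' {c} = ⋃ i, φ i '' ((E ∘ φ i) ⁻¹' {c}) := by
    rw [← hφ.iUnion_range_eq hX h0, iUnion_inter]
    refine iUnion_congr fun i => ?_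
    rw [preimage_comp, image_preimage_eq_range_inter]
  have hdisj : Pairwise (Function.onFun Disjoint fun i => φ i '' ((E ∘ φ i) ⁻¹' {c})) := by
    intro i j hij
    have := hφ.disjoint_interiors i j hij
    rw [C0Manifold.interior_eq_univ (h0 i), C0Manifold.interior_eq_univ (h0 j)] at this
    exact this.mono (image_mono (subset_univ _)) (image_mono (subset_univ _))
  have hcomp : IsCompact (E ⁻¹' {c}) :=
    (hcompact c).of_isClosed_subset (hE.isClosed_fiber c)
      (preimage_mono (singleton_subset_iff.2 self_mem_Iic))
  have heven := ncard_boundary_inter_eq_zero hB hcomp (hE.isOpen_fiber c)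
  have hcard : (C0Manifold.boundary X ∩ E ⁻¹' {c}).ncard =
      ∑ i, ((E ∘ φ i) ⁻¹' {c}).ncard := by
    rw [hunion, ncard_iUnion_of_finite (fun i => (hlevel i c).image _) hdisj, finsum_eq_sum_of_fintype]
    exact Finset.sum_congr rfl fun i _ => ncard_image_of_injective _ (hφ.isEmbedding i).injective
  rw [hcard, Nat.cast_sum] at heven
  simpa [novikovCount] using heven
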